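/- Let $n\ge 2$ and let $S=\{a_1,\dots,a_n\}$ be a set of cardinality $n$. Let $M_n$ be the free monoid on $S$ (all words over $S$), and let $F_n$ be the free group on $S$, whose elements are identified with the reduced words over $\bar S=\{a_1^{\pm1},\dots,a_n^{\pm1}\}$. Let $X$ be $M_n$ or $F_n$. For $v\in X$ nonempty, the counting function $\rho_v:X\to\mathbb R$ sends $w$ to the number of (possibly overlapping) occurrences of the (reduced) word $v$ as a block of consecutive letters of the (reduced) word $w$; $\rho_e(w)$ is the length of $w$. Let $\mathcal C(X)$ be the real vector space spanned by all $\rho_v$, let $\widehat{\mathcal C}(X)$ be its quotient by the subspace of bounded functions in $\mathcal C(X)$, and let $\widehat{\mathcal C}(X)_L\subset\widehat{\mathcal C}(X)$ be the span of the classes $[\rho_w]$ with $|w|=L$. For a set $W$ of words of length $L$ in $X$, say that $B(W)=\{\rho_w\mid w\in W\}$ is a pure basis of $\widehat{\mathcal C}(X)_L$ if the family $([\rho_w])_{w\in W}$, indexed by $W$, is a basis of $\widehat{\mathcal C}(X)_L$. Let $\Gamma_L(S)$ be the de Bruijn graph: the undirected multigraph (loops and multiple edges allowed) with vertex set $S^{L-1}$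 and edge set $S^L$, in which the edge $w$ joins the two words obtained from $w$ by deleting its first, respectively last, letter. Let $\Gamma_L(M_n)$ be the simple graph obtained from $\Gamma_L(S)$ by deleting loops and collapsing multiple edges to single edges. Let $\bar S^{(L)}$ be the set of reduced words of length $L$ over $\bar S$, and let $\Gamma_L(\bar S)$ be the Martin–de Bruijn graph: the undirected multigraph with vertex set $\bar S^{(L-1)}$ and edge set $\bar S^{(L)}$, with the same incidence rule. **(Monoid case)** Let $L\ge1$, and let $W\subset S^L$ be a set of cardinality $|W|=(n-1)n^{L-1}+1$. Then the following are equivalent. * (i) $B(W)$ is a pure basis of $\widehat{\mathcal C}(M_n)_L$. * (ii) The subgraph of $\Gamma_L(S)$ (or, equivalently, of $\Gamma_L(M_n)$) with vertex set $S^{L-1}$ and edges labelled by $S^L\setminus W$ is connected. * (iii) The subgraph of $\Gamma_L(S)$ with vertex set $S^{L-1}$ and edges labelled by $S^L\setminus W$ is a spanning tree of $\Gamma_L(S)$. Moreover $\dim\widehat{\mathcal C}(M_n)_L=(n-1)n^{L-1}+1$, and sending $W$ to the subgraph of $\Gamma_L(S)$ with vertex set $S^{L-1}$ and edge set $S^L\setminus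 W$ is a bijection from the set of all $W\subset S^L$ for which $B(W)$ is a pure basis of $\widehat{\mathcal C}(M_n)_L$ onto the set of spanning trees of $\Gamma_L(S)$. **(Group case)** Let $L\ge2$, and let $W\subset\bar S^{(L)}$ be a set of cardinality $|W|=2n(2n-1)^{L-2}(2n-2)+1$. Then the following are equivalent. * (i) $B(W)$ is a pure basis of $\widehat{\mathcal C}(F_n)_L$. * (ii) The subgraph of $\Gamma_L(\bar S)$ with vertex set $\bar S^{(L-1)}$ and edges labelled by $\bar S^{(L)}\setminus W$ is connected. * (iii) The subgraph of $\Gamma_L(\bar S)$ with vertex set $\bar S^{(L-1)}$ and edges labelled by $\bar S^{(L)}\setminus W$ is a spanning tree of $\Gamma_L(\bar S)$. Moreover $\dim\widehat{\mathcal C}(F_n)_L=2n(2n-1)^{L-2}(2n-2)+1$, and sending $W$ to the subgraph of $\Gamma_L(\bar S)$ with vertex set $\bar S^{(L-1)}$ and edge set $\bar S^{(L)}\setminus W$ is a bijection from the set of all $W\subset\bar S^{(L)}$ for which $B(W)$ is a pure basis of $\widehat{\mathcal C}(F_n)_L$ onto the set of spanning trees of $\Gamma_L(\bar S)$. -/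

import Mathlib

open scoped Finset

namespace CountingFunctions

/-! ### Counting functions and their classes modulo bounded functions

The free monoid and the free group on `S` are treated together.  In both cases an element `x` is
a (reduced) word, and `nf x : List A` is that word, written as a list of letters:
`nf = FreeMonoid.toList` with `A = S`, respectively `nf = FreeGroup.toWord` with `A = S × Bool`. -/

section Counting

variable {A X : Type*} [DecidableEq A]

/-- The number of (possibly overlapping) occurrences of the word `v` as a block of consecutive
letters of `w`; by convention it is the length of `w` if `v` is empty. -/
def occurrences (v w : List A) : ℕ :=
  if v = [] then w.length else #{j ∈ Finset.range w.length | v <+: w.drop j}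

/-- The counting function `ρ_v`, as a real-valued function. -/
def countingFunction (nf : X → List A) (v : X) : X → ℝ :=
  fun w => (occurrences (nf v) (nf w) : ℝ)

/-- The space `C` of functions spanned by all counting functions. -/
def countingSpace (nf : X → List A) : Submodule ℝ (X → ℝ) :=
  Submodule.span ℝ (Set.range (countingFunction nf))

/-- The space of bounded real-valued functions on `X`. -/
def boundedFunctions (X : Type*) : Submodule ℝ (X → ℝ) where
  carrier := {f | ∃ C : ℝ, ∀ x, |f x| ≤ C}
  zero_mem' := ⟨0, fun x => by simp⟩
  add_mem' := by
    rintro f g ⟨C, hC⟩ ⟨D, hD⟩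
    exact ⟨C + D, fun x => (abs_add_le _ _).trans (add_le_add (hC x) (hD x))⟩
  smul_mem' := by
    rintro c f ⟨C, hC⟩
    refine ⟨|c| * C, fun x => ?_⟩
    simpa [abs_mul] using mul_le_mul_of_nonneg_left (hC x) (abs_nonneg c)

/-- The space `Ĉ` of equivalence classes in `C`, where two functions are equivalent if they differ
by a bounded function. -/
abbrev CountingClasses (nf : X → List A) : Type _ :=
  countingSpace nf ⧸ (boundedFunctions X).submoduleOf (countingSpace nf)

/-- The class `[ρ_v]` in `Ĉ`. -/
def countingClass (nf : X → List A) (v : X) : CountingClasses nf :=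
  Submodule.Quotient.mk ⟨countingFunction nf v, Submodule.subset_span ⟨v, rfl⟩⟩

/-- The set of words of length `L`. -/
def wordsOfLength (nf : X → List A) (L : ℕ) : Set X :=
  {w | (nf w).length = L}

/-- The linear map from finitely supported functions to `Ĉ` that sends `δ_w` to `[ρ_w]`. -/
noncomputable def toClass (nf : X → List A) : (X →₀ ℝ) →ₗ[ℝ] CountingClasses nf :=
  Finsupp.linearCombination ℝ (countingClass nf)

/-- The subspace `Ĉ_L`: the image in `Ĉ` of the finitely supported functions all of whose support
consists of words of length `L`. -/
noncomputable def pureClasses (nf : X → List A) (L : ℕ) : Submodule ℝ (CountingClasses nf) :=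
  (Finsupp.supported ℝ ℝ (wordsOfLength nf L)).map (toClass nf)

/-- `W` is a set of words of length `L` such that the family `([ρ_w])`, `w ∈ W`, is a basis of
`Ĉ_L`. -/
structure IsPureBasis (nf : X → List A) (L : ℕ) (W : Set X) : Prop where
  subset : W ⊆ wordsOfLength nf L
  linearIndepOn : LinearIndepOn ℝ (countingClass nf) W
  span_eq : Submodule.span ℝ (countingClass nf '' W) = pureClasses nf L

end Counting

/-! ### Connectedness and spanning trees for multigraphs -/

section Graphs

variable {V E : Type*}

/-- A multigraph is connected if it has a vertex and any two vertices are joined by a path. -/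
def IsConnected (G : Graph V E) : Prop :=
  G.vertexSet.Nonempty ∧
    ∀ x ∈ G.vertexSet, ∀ y ∈ G.vertexSet, Relation.ReflTransGen G.Adj x y

/-- A multigraph is acyclic if it has no cycle, i.e. no cyclic sequence of `k + 1 ≥ 1` distinct
vertices and `k + 1` distinct edges, the `i`-th edge joining the `i`-th vertex to the next one
(indices are modulo `k + 1`).  Loops and pairs of parallel edges are cycles. -/
def IsAcyclic (G : Graph V E) : Prop :=
  ¬ ∃ (k : ℕ) (v : Fin (k + 1) → V) (e : Fin (k + 1) → E),
    Function.Injective v ∧ Function.Injective e ∧ ∀ i, G.IsLink (e i) (v i) (v (i + 1))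

/-- `T` is a spanning tree of `G`: a connected acyclic subgraph that contains all vertices. -/
structure IsSpanningTree (T G : Graph V E) : Prop where
  spanning : T.IsSpanningSubgraph G
  connected : IsConnected T
  acyclic : IsAcyclic T

end Graphs

/-! ### De Bruijn and Martin–de Bruijn graphs -/

/-- The `L`-th de Bruijn graph (`L ≥ 1`): the vertices are the words of length `L - 1`, the edges
are the words of length `L`, and the edge `e` joins the two words obtained from `e` by deleting
the first, respectively the last, letter. -/
def deBruijnGraph (S : Type*) (L : ℕ) : Graph (FreeMonoid S) (FreeMonoid S) where
  vertexSet := wordsOfLength FreeMonoid.toList (L - 1)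
  edgeSet := wordsOfLength FreeMonoid.toList L
  IsLink e x y := e ∈ wordsOfLength FreeMonoid.toList L ∧
    ((x.toList = e.toList.tail ∧ y.toList = e.toList.dropLast) ∨
      (x.toList = e.toList.dropLast ∧ y.toList = e.toList.tail))
  isLink_symm e _ := ⟨by rintro x y ⟨he, h⟩; exact ⟨he, by tauto⟩⟩
  eq_or_eq_of_isLink_of_isLink := by
    rintro e x y v w ⟨_, h⟩ ⟨_, h'⟩
    have key : ∀ {a b : FreeMonoid S} {l : List S}, a.toList = l → b.toList = l → a = b :=
      fun ha hb => FreeMonoid.toList.injective (ha.trans hb.symm)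
    rcases h with ⟨h1, h2⟩ | ⟨h1, h2⟩ <;> rcases h' with ⟨h3, h4⟩ | ⟨h3, h4⟩
    · exact Or.inl (key h1 h3)
    · exact Or.inr (key h1 h4)
    · exact Or.inr (key h1 h4)
    · exact Or.inl (key h1 h3)
  edge_mem_iff_exists_isLink e :=
    ⟨fun he => ⟨FreeMonoid.ofList e.toList.tail, FreeMonoid.ofList e.toList.dropLast, he,
      Or.inl ⟨rfl, rfl⟩⟩, fun ⟨_, _, he, _⟩ => he⟩
  left_mem_of_isLink := by
    rintro e x y ⟨he, ⟨h, -⟩ | ⟨h, -⟩⟩ <;>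
      simp only [wordsOfLength, Set.mem_ofPred_eq] at he ⊢ <;> rw [h] <;> simp [he]

/-- The `L`-th Martin–de Bruijn graph (`L ≥ 1`): the vertices are the reduced words of length
`L - 1` over the symmetrized alphabet, the edges are the reduced words of length `L`, and the edge
`e` joins the two words obtained from `e` by deleting the first, respectively the last, letter. -/
def martinDeBruijnGraph (S : Type*) [DecidableEq S] (L : ℕ) :
    Graph (FreeGroup S) (FreeGroup S) where
  vertexSet := wordsOfLength FreeGroup.toWord (L - 1)
  edgeSet := wordsOfLength FreeGroup.toWord L
  IsLink e x y := e ∈ wordsOfLength FreeGroup.toWord L ∧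
    ((x.toWord = e.toWord.tail ∧ y.toWord = e.toWord.dropLast) ∨
      (x.toWord = e.toWord.dropLast ∧ y.toWord = e.toWord.tail))
  isLink_symm e _ := ⟨by rintro x y ⟨he, h⟩; exact ⟨he, by tauto⟩⟩
  eq_or_eq_of_isLink_of_isLink := by
    rintro e x y v w ⟨_, h⟩ ⟨_, h'⟩
    have key : ∀ {a b : FreeGroup S} {l : List (S × Bool)}, a.toWord = l → b.toWord = l → a = b :=
      fun ha hb => FreeGroup.toWord_injective (ha.trans hb.symm)
    rcases h with ⟨h1, h2⟩ | ⟨h1, h2⟩ <;> rcases h' with ⟨h3, h4⟩ | ⟨h3, h4⟩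
    · exact Or.inl (key h1 h3)
    · exact Or.inr (key h1 h4)
    · exact Or.inr (key h1 h4)
    · exact Or.inl (key h1 h3)
  edge_mem_iff_exists_isLink e := by
    refine ⟨fun he => ⟨FreeGroup.mk e.toWord.tail, FreeGroup.mk e.toWord.dropLast, he,
      Or.inl ⟨?_, ?_⟩⟩, fun ⟨_, _, he, _⟩ => he⟩
    · rw [FreeGroup.toWord_mk]
      exact (FreeGroup.isReduced_toWord.infix (List.tail_suffix _).isInfix).reduce_eq
    · rw [FreeGroup.toWord_mk]
      exact (FreeGroup.isReduced_toWord.infix (List.dropLast_prefix _).isInfix).reduce_eq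
  left_mem_of_isLink := by
    rintro e x y ⟨he, ⟨h, -⟩ | ⟨h, -⟩⟩ <;>
      simp only [wordsOfLength, Set.mem_ofPred_eq] at he ⊢ <;> rw [h] <;> simp [he]

end CountingFunctions

namespace CountingFunctions

/-! ### Connected multigraphs, potentials and cycles -/

section GraphTheory

open Graph

variable {V E : Type*} {G : Graph V E}

/-! Orient each edge `e` from `s e`, the word without its first letter, to `t e`, the word without
its last. The theorem rests on one fact (`exists_abs_weightedCount_le_iff`): a combination `∑ f e •
ρ_e` over words of length `L` is bounded iff `f` is a coboundary, `f e = φ (t e) - φ (s e)`. A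
coboundary telescopes along a word, so only two end windows contribute. Conversely, let `φ k` be the
supremum of a bounded combination over words beginning with `k`; prepending a letter shows that `f`
is at most the coboundary of `φ`. The difference has nonnegative coefficients and is still bounded,
so it vanishes: a word repeating `e` often would make a positive coefficient at `e` unbounded.

The rest is the cographic matroid. A relation supported on `W` is the coboundary of a function
constant across every edge outside `W`, so `W` is independent iff deleting `W` leaves the graph
connected (`linearIndepOn_iff_isConnected_deleteEdges`). Coboundaries have dimension `|V| - 1`,
hence the span has dimension `|E| - |V| + 1`, and complements of bases have the edge number of a
spanning tree. Monoid and group are treated together as words whose consecutive letters satisfy a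
relation `R`. -/

theorem isConnected_iff_forall_potential : IsConnected G ↔ V(G).Nonempty ∧
    ∀ φ : V → ℝ, (∀ e x y, G.IsLink e x y → φ x = φ y) →
      ∀ x ∈ V(G), ∀ y ∈ V(G), φ x = φ y := by
  refine and_congr_right fun _ => ⟨fun h φ hφ x hx y hy => ?_, fun h x hx y hy => ?_⟩
  · have := h x hx y hy
    induction this with
    | refl => rfl
    | tail _ hbc ih =>
      obtain ⟨e, he⟩ := hbc
      exact (ih he.left_mem).trans (hφ _ _ _ he)
  · classical
    -- The test potential is the indicator of the set reachable from `x`.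
    have := h (fun z => if Relation.ReflTransGen G.Adj x z then 1 else 0) (fun e a b hab => by
      have : Relation.ReflTransGen G.Adj x a ↔ Relation.ReflTransGen G.Adj x b :=
        ⟨fun h => h.tail ⟨e, hab⟩, fun h => h.tail ⟨e, hab.symm⟩⟩
      simp [this]) x hx y hy
    by_contra hxy
    simp [hxy, Relation.ReflTransGen.refl] at this

theorem IsConnected.eq_of_forall_isLink (hG : IsConnected G) {φ : V(G) → ℝ}
    (h : ∀ e x y, (hxy : G.IsLink e x y) → φ ⟨x, hxy.left_mem⟩ = φ ⟨y, hxy.right_mem⟩)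
    (x y : V(G)) : φ x = φ y := by
  have key : ∀ z : V(G), Function.extend Subtype.val φ 0 z.1 = φ z :=
    fun z => Subtype.val_injective.extend_apply φ 0 z
  have := (isConnected_iff_forall_potential.1 hG).2 (Function.extend Subtype.val φ 0)
    (fun e a b hab => by
      rw [key ⟨a, hab.left_mem⟩, key ⟨b, hab.right_mem⟩]
      exact h e a b hab) x x.2 y y.2
  rwa [key, key] at this

/-- The coboundary map from functions on vertices to functions on edges, for edges `ι` with
sources `s` and targets `t`. -/
def coboundary {ι κ : Type*} (s t : ι → κ) : (κ → ℝ) →ₗ[ℝ] (ι → ℝ) :=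
  LinearMap.funLeft ℝ ℝ t - LinearMap.funLeft ℝ ℝ s

@[simp]
theorem coboundary_apply {ι κ : Type*} (s t : ι → κ) (φ : κ → ℝ) (e : ι) :
    coboundary s t φ e = φ (t e) - φ (s e) := rfl

theorem eq_of_coboundary_eq_zero {s t : E(G) → V(G)}
    (hst : ∀ e : E(G), G.IsLink (e : E) (s e : V) (t e : V)) {φ : V(G) → ℝ} {e : E} {x y : V}
    (hxy : G.IsLink e x y) (h : coboundary s t φ ⟨e, hxy.edge_mem⟩ = 0) :
    φ ⟨x, hxy.left_mem⟩ = φ ⟨y, hxy.right_mem⟩ := by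
  have h' : φ (t ⟨e, hxy.edge_mem⟩) = φ (s ⟨e, hxy.edge_mem⟩) := sub_eq_zero.1 h
  rcases hxy.eq_and_eq_or_eq_and_eq (hst ⟨e, hxy.edge_mem⟩) with ⟨h1, h2⟩ | ⟨h1, h2⟩
  · rw [show (⟨x, hxy.left_mem⟩ : V(G)) = s _ from Subtype.ext h1,
      show (⟨y, hxy.right_mem⟩ : V(G)) = t _ from Subtype.ext h2, h']
  · rw [show (⟨x, hxy.left_mem⟩ : V(G)) = t _ from Subtype.ext h1,
      show (⟨y, hxy.right_mem⟩ : V(G)) = s _ from Subtype.ext h2, h']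

/-- Rank-nullity: by connectedness the kernel consists of the constants. -/
theorem IsConnected.finrank_range_coboundary [Finite V(G)] (hG : IsConnected G)
    {s t : E(G) → V(G)} (hst : ∀ e : E(G), G.IsLink (e : E) (s e : V) (t e : V)) :
    Module.finrank ℝ (coboundary s t).range + 1 = V(G).ncard := by
  have := Fintype.ofFinite V(G)
  have hker : (coboundary s t).ker = Submodule.span ℝ {1} := by
    ext φ
    rw [LinearMap.mem_ker, Submodule.mem_span_singleton]
    constructor
    · intro h
      obtain ⟨x, hx⟩ := hG.1
      refine ⟨φ ⟨x, hx⟩, funext fun y => ?_⟩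
      simpa using hG.eq_of_forall_isLink (φ := φ)
        (fun e a b hab => eq_of_coboundary_eq_zero hst hab (congrFun h _)) ⟨x, hx⟩ y
    · rintro ⟨c, rfl⟩
      ext e
      simp
  have h1 : Module.finrank ℝ (coboundary s t).ker = 1 := by
    rw [hker]
    refine finrank_span_singleton fun h => ?_
    obtain ⟨x, hx⟩ := hG.1
    simpa using congrFun h ⟨x, hx⟩
  rw [← h1, LinearMap.finrank_range_add_finrank_ker, Module.finrank_fintype_fun_eq_card,
    Set.ncard_eq_toFinset_card', Set.toFinset_card]

theorem exists_source_target (G : Graph V E) :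
    ∃ s t : E(G) → V(G), ∀ e : E(G), G.IsLink (e : E) (s e : V) (t e : V) := by
  have h : ∀ e : E(G), ∃ x y : V(G), G.IsLink (e : E) (x : V) (y : V) := fun e => by
    obtain ⟨x, y, h⟩ := exists_isLink_of_mem_edgeSet e.2
    exact ⟨⟨x, h.left_mem⟩, ⟨y, h.right_mem⟩, h⟩
  choose s t h using h
  exact ⟨s, t, h⟩

theorem IsConnected.ncard_vertexSet_le [Finite V(G)] [Finite E(G)] (hG : IsConnected G) :
    V(G).ncard ≤ E(G).ncard + 1 := by
  have := Fintype.ofFinite E(G)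
  obtain ⟨s, t, hst⟩ := exists_source_target G
  have h := Submodule.finrank_le (coboundary s t).range
  rw [Module.finrank_fintype_fun_eq_card, ← Set.toFinset_card, ← Set.ncard_eq_toFinset_card'] at h
  rw [← hG.finrank_range_coboundary hst]
  lia

/-- If there are more edges than in a spanning tree, then some edge may be deleted. -/
theorem IsConnected.exists_isConnected_deleteEdges [Finite V(G)] [Finite E(G)]
    (hG : IsConnected G) (h : V(G).ncard < E(G).ncard + 1) :
    ∃ e ∈ E(G), IsConnected (G.deleteEdges {e}) := by
  have := Fintype.ofFinite E(G)
  obtain ⟨s, t, hst⟩ := exists_source_target G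
  have hne : (coboundary s t).range ≠ ⊤ := by
    intro htop
    have h1 := hG.finrank_range_coboundary hst
    rw [htop, finrank_top, Module.finrank_fintype_fun_eq_card, ← Set.toFinset_card,
      ← Set.ncard_eq_toFinset_card'] at h1
    lia
  -- A functional killing all coboundaries plays the role of a cycle, and any edge in its support
  -- can be deleted.
  obtain ⟨z, hz0, hz⟩ := Submodule.exists_le_ker_of_lt_top _ (lt_top_iff_ne_top.2 hne)
  classical
  obtain ⟨e, he⟩ : ∃ e, z (Pi.single e 1) ≠ 0 := by
    by_contra! hall
    exact hz0 (LinearMap.pi_ext' fun e => LinearMap.ext_ring (by simpa using hall e))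
  refine ⟨e, e.2, isConnected_iff_forall_potential.2 ⟨hG.1, fun φ hφ => ?_⟩⟩
  refine (isConnected_iff_forall_potential.1 hG).2 φ fun f x y hf => ?_
  by_cases hfe : f = e
  · subst hfe
    set ψ : V(G) → ℝ := fun v => φ v
    -- A potential of the graph without `e` has its coboundary concentrated at `e`; applying `z`
    -- shows that this last value vanishes too.
    have hsingle : coboundary s t ψ = coboundary s t ψ e • Pi.single e (1 : ℝ) := by
      ext f
      by_cases hfe : f = e
      · subst hfe; simp
      · have : φ (s f) = φ (t f) :=
          hφ f _ _ ⟨hst f, fun h => hfe (Subtype.ext h)⟩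
        simp [hfe, ψ, this]
    have h0 : z (coboundary s t ψ) = 0 := hz ⟨ψ, rfl⟩
    rw [hsingle, map_smul, smul_eq_mul, mul_eq_zero] at h0
    exact eq_of_coboundary_eq_zero hst hf (h0.resolve_right he)
  · exact hφ f x y ⟨hf, hfe⟩

/-- Deleting an edge of a cycle would preserve connectedness and leave fewer edges than
`IsConnected.ncard_vertexSet_le` allows. -/
theorem IsConnected.isAcyclic [Finite V(G)] [Finite E(G)] (hG : IsConnected G)
    (h : E(G).ncard + 1 = V(G).ncard) : IsAcyclic G := by
  rintro ⟨k, v, e, -, he, hve⟩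
  have hconn : IsConnected (G.deleteEdges {e (Fin.last k)}) := by
    refine isConnected_iff_forall_potential.2 ⟨hG.1, fun φ hφ => ?_⟩
    refine (isConnected_iff_forall_potential.1 hG).2 φ fun f x y hf => ?_
    by_cases hfe : f = e (Fin.last k)
    · subst hfe
      -- Going from `v 0` to `v k` uses every edge of the cycle but the deleted last one, which
      -- closes it up.
      have hconst : ∀ i : Fin (k + 1), φ (v i) = φ (v 0) := by
        intro i
        induction i using Fin.induction with
        | zero => rfl
        | succ i ih =>
          rw [← ih]
          have := hφ (e i.castSucc) _ _ ⟨hve _, fun h => (Fin.castSucc_lt_last i).ne (he h)⟩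
          simpa using this.symm
      rcases hf.eq_and_eq_or_eq_and_eq (hve _) with ⟨rfl, rfl⟩ | ⟨rfl, rfl⟩ <;>
        simp only [hconst]
    · exact hφ f x y ⟨hf, hfe⟩
  have : Finite V(G.deleteEdges {e (Fin.last k)}) := ‹Finite V(G)›
  have : Finite E(G.deleteEdges {e (Fin.last k)}) := Set.Finite.subset (s := E(G)) (Set.toFinite _) Set.sdiff_subset
  have h1 := hconn.ncard_vertexSet_le
  have h2 : E(G.deleteEdges {e (Fin.last k)}).ncard < E(G).ncard :=
    Set.ncard_sdiff_singleton_lt_of_mem (hve _).edge_mem (Set.toFinite _)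
  have h3 : V(G.deleteEdges {e (Fin.last k)}).ncard = V(G).ncard := rfl
  lia

/-- Steps along loops do not move and can be dropped from a path; parallel edges give the same
adjacency. -/
theorem isConnected_iff_connected_toSimpleGraph :
    IsConnected G ↔ G.toSimpleGraph.Connected := by
  rw [SimpleGraph.connected_iff, and_comm, Set.nonempty_coe_sort]
  refine and_congr_right fun _ => ⟨fun h x y => ?_, fun h x hx y hy => ?_⟩
  · have := h x x.2 y y.2
    obtain ⟨y, hy⟩ := y
    simp only at this
    induction this with
    | refl => rfl
    | @tail b c _ hbc ih =>
      refine (ih hbc.left_mem).trans ?_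
      by_cases hne : b = c
      · subst hne; rfl
      · exact SimpleGraph.Adj.reachable ⟨fun h => hne (congrArg Subtype.val h), hbc⟩
  · have := h ⟨x, hx⟩ ⟨y, hy⟩
    rw [SimpleGraph.reachable_iff_reflTransGen] at this
    exact this.lift (p := G.Adj) Subtype.val fun a b hab => hab.2

/-- A simple path closed up by a further edge is a cycle. -/
theorem not_isAcyclic_of_isConnected_deleteEdges {e : E} (he : e ∈ E(G))
    (h : IsConnected (G.deleteEdges {e})) : ¬ IsAcyclic G := by
  obtain ⟨x, y, hxy⟩ := exists_isLink_of_mem_edgeSet he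
  obtain ⟨p, hp⟩ := ((isConnected_iff_connected_toSimpleGraph.1 h).preconnected
    ⟨x, hxy.left_mem⟩ ⟨y, hxy.right_mem⟩).exists_isPath
  have hadj : ∀ i, i < p.length → ∃ f, (G.deleteEdges {e}).IsLink f
      (p.getVert i) (p.getVert (i + 1)) := fun i hi => (p.adj_getVert_succ hi).2
  have : Nonempty E := ⟨e⟩
  choose! f hf using hadj
  have hinj := hp.getVert_injOn
  -- The edge `e` closes the path at its last index. If `e` is a loop, the path has length 0 and the
  -- cycle is `e` alone.
  refine not_not.2 ⟨p.length, fun i => p.getVert i,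
    fun i => if (i : ℕ) < p.length then f i else e, ?_, ?_, ?_⟩
  · intro i j hij
    exact Fin.ext (hinj (Nat.lt_succ_iff.1 i.2) (Nat.lt_succ_iff.1 j.2) (Subtype.ext hij))
  · intro i j hij
    simp only at hij
    split_ifs at hij with hi hj hj
    · have h1 := hf i hi
      have h2 := hf j hj
      rw [← hij] at h2
      rcases h1.eq_and_eq_or_eq_and_eq h2 with ⟨h3, -⟩ | ⟨h3, h4⟩
      · exact Fin.ext (hinj hi.le hj.le (Subtype.ext h3))
      -- Traversing one edge in opposite directions would force `i = j + 1` and `j = i + 1`.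
      · have h3 := hinj hi.le (show (j : ℕ) + 1 ≤ _ from hj) (Subtype.ext h3)
        have h4 := hinj (show (i : ℕ) + 1 ≤ _ from hi) hj.le (Subtype.ext h4)
        lia
    · exact absurd hij (hf i hi).2
    · exact absurd hij.symm (hf j hj).2
    · exact Fin.ext (by lia)
  · intro i
    by_cases hi : (i : ℕ) < p.length
    · have : ((i + 1 : Fin (p.length + 1)) : ℕ) = i + 1 := Fin.val_add_one_of_lt' (by lia)
      simpa only [hi, if_true, this] using (hf i hi).1
    · obtain rfl : i = Fin.last _ := Fin.ext (by simp; lia)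
      simpa using hxy.symm

/-- A connected finite multigraph is acyclic iff it has one edge less than it has vertices. -/
theorem IsConnected.isAcyclic_iff [Finite V(G)] [Finite E(G)] (hG : IsConnected G) :
    IsAcyclic G ↔ E(G).ncard + 1 = V(G).ncard := by
  refine ⟨fun h => ?_, hG.isAcyclic⟩
  by_contra hne
  obtain ⟨e, he, hconn⟩ := hG.exists_isConnected_deleteEdges
    (lt_of_le_of_ne hG.ncard_vertexSet_le (Ne.symm hne))
  exact not_isAcyclic_of_isConnected_deleteEdges he hconn h

end GraphTheory

/-! ### Vectors whose linear relations are the coboundaries of a graph -/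

section Cographic

open Graph

variable {V E Q : Type*} {G : Graph V E} [AddCommGroup Q] [Module ℝ Q] {c : E → Q}
  {s t : E(G) → V(G)} [Fintype E(G)]

/-- Relations on `W` become edge functions vanishing off `W`, which can be compared with
coboundaries. -/
theorem linearIndepOn_iff_of_subset {W : Set E} (hW : W ⊆ E(G)) : LinearIndepOn ℝ c W ↔
    ∀ f : E(G) → ℝ, (∀ e : E(G), (e : E) ∉ W → f e = 0) → ∑ e, f e • c e = 0 → f = 0 := by
  have hWim : W = Subtype.val '' {e : E(G) | (e : E) ∈ W} := by
    ext e
    simpa using fun h => hW h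
  have hcomp : LinearIndepOn ℝ c W ↔
      LinearIndepOn ℝ (c ∘ Subtype.val) {e : E(G) | (e : E) ∈ W} := by
    conv_lhs => rw [hWim]
    exact ⟨fun h => h.comp_of_image Subtype.val_injective.injOn, LinearIndepOn.image_of_comp _ _⟩
  rw [hcomp, linearIndepOn_iff]
  refine ⟨fun h f hf hsum => ?_, fun h f hf hsum => ?_⟩
  · have := h (Finsupp.equivFunOnFinite.symm f)
      ((Finsupp.mem_supported' _ _).2 fun e he => by simpa using hf e he)
      (by simpa [Finsupp.linearCombination_apply, Finsupp.sum_fintype] using hsum)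
    exact Finsupp.equivFunOnFinite.symm.injective (this.trans (by ext; rfl))
  · have := h f (fun e he => (Finsupp.mem_supported' _ _).1 hf e he)
      (by simpa [Finsupp.linearCombination_apply, Finsupp.sum_fintype] using hsum)
    exact DFunLike.coe_injective this


/-- If the linear relations between vectors indexed by the edges of a connected graph are the
coboundaries, then a subfamily is independent iff deleting its edges leaves a connected graph. -/
theorem linearIndepOn_iff_isConnected_deleteEdges (hG : IsConnected G)
    (hst : ∀ e : E(G), G.IsLink (e : E) (s e : V) (t e : V))
    (hc : ∀ f : E(G) → ℝ, ∑ e, f e • c e = 0 ↔ f ∈ (coboundary s t).range)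
    {W : Set E} (hW : W ⊆ E(G)) :
    LinearIndepOn ℝ c W ↔ IsConnected (G.deleteEdges W) := by
  rw [linearIndepOn_iff_of_subset hW, isConnected_iff_forall_potential]
  constructor
  · refine fun h => ⟨hG.1, fun φ hφ => ?_⟩
    set ψ : V(G) → ℝ := fun v => φ v
    have h0 := h (coboundary s t ψ)
      (fun e he => sub_eq_zero.2 (hφ e _ _ ⟨hst e, he⟩).symm) ((hc _).2 ⟨ψ, rfl⟩)
    exact (isConnected_iff_forall_potential.1 hG).2 φ fun e x y hxy =>
      eq_of_coboundary_eq_zero hst hxy (congrFun h0 _)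
  · rintro ⟨-, h⟩ f hf hsum
    obtain ⟨φ, rfl⟩ := (hc f).1 hsum
    have key : ∀ z : V(G), Function.extend Subtype.val φ 0 z.1 = φ z :=
      fun z => Subtype.val_injective.extend_apply φ 0 z
    have hconst := h (Function.extend Subtype.val φ 0) fun e x y hxy => by
      obtain ⟨hxy, he⟩ := hxy
      rw [key ⟨x, hxy.left_mem⟩, key ⟨y, hxy.right_mem⟩]
      exact eq_of_coboundary_eq_zero hst hxy (hf ⟨e, hxy.edge_mem⟩ he)
    ext e
    have := hconst _ (t e).2 _ (s e).2
    rw [key, key] at this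
    exact sub_eq_zero.2 this

/-- Rank-nullity for the map from edge functions to combinations, whose kernel is the space of
coboundaries. -/
theorem finrank_span_add_ncard_vertexSet [Finite V(G)] (hG : IsConnected G)
    (hst : ∀ e : E(G), G.IsLink (e : E) (s e : V) (t e : V))
    (hc : ∀ f : E(G) → ℝ, ∑ e, f e • c e = 0 ↔ f ∈ (coboundary s t).range) :
    Module.finrank ℝ (Submodule.span ℝ (c '' E(G))) + V(G).ncard = E(G).ncard + 1 := by
  have hker : (Fintype.linearCombination ℝ (fun e : E(G) => c e)).ker = (coboundary s t).range := by
    ext f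
    rw [LinearMap.mem_ker, Fintype.linearCombination_apply, hc]
  have h := LinearMap.finrank_range_add_finrank_ker
    (Fintype.linearCombination ℝ (fun e : E(G) => c e))
  rw [hker, Fintype.range_linearCombination, Module.finrank_fintype_fun_eq_card,
    ← Set.image_eq_range, ← Set.toFinset_card, ← Set.ncard_eq_toFinset_card'] at h
  rw [← hG.finrank_range_coboundary hst, ← h, add_assoc]

end Cographic

/-! ### Bounded combinations of counting functions -/

section Words

variable {A : Type*}

theorem occurrences_cons [DecidableEq A] {v : List A} (hv : v ≠ []) (a : A) (l : List A) :
    occurrences v (a :: l) = occurrences v l + if v <+: a :: l then 1 else 0 := by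
  simp only [occurrences, hv, if_false, List.length_cons, Finset.card_filter,
    Finset.sum_range_succ', List.drop_succ_cons, List.drop_zero]

theorem occurrences_eq_zero_of_length_lt [DecidableEq A] {v l : List A}
    (h : l.length < v.length) : occurrences v l = 0 := by
  have hv : v ≠ [] := by rintro rfl; simp at h
  simp only [occurrences, hv, if_false, Finset.card_eq_zero, Finset.filter_eq_empty_iff]
  intro j _ hj
  have := hj.length_le
  rw [List.length_drop] at this
  lia

theorem occurrences_le_append [DecidableEq A] {v : List A} (hv : v ≠ []) (l m : List A) :
    occurrences v m ≤ occurrences v (l ++ m) := by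
  induction l with
  | nil => rfl
  | cons a l ih => rw [List.cons_append, occurrences_cons hv]; lia

/-- `w` enumerates, without repetition, the words of length `L` in which any two consecutive
letters are related by `R`. -/
structure IsEnumeration (R : A → A → Prop) (L : ℕ) {ι : Type*} (w : ι → List A) : Prop where
  injective : Function.Injective w
  isChain : ∀ i, (w i).IsChain R
  length_eq : ∀ i, (w i).length = L
  exists_eq : ∀ l, l.IsChain R → l.length = L → ∃ i, w i = l

variable {R : A → A → Prop} {L : ℕ} {ι κ : Type*} {w : ι → List A} {v : κ → List A}

theorem IsEnumeration.ne_nil (hw : IsEnumeration R L w) (hL : 1 ≤ L) (i : ι) : w i ≠ [] := by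
  intro h
  have := hw.length_eq i
  rw [h] at this
  simp at this
  lia

/-- Prepend a further copy of `e`, separated by a linking letter. Keeping `e` as a prefix of `l`
fixes the letter that the link must reach. -/
theorem exists_isChain_le_occurrences [DecidableEq A] (hR : ∀ a b, ∃ c, R a c ∧ R c b)
    {e : List A} (he : e.IsChain R) (hne : e ≠ []) (m : ℕ) :
    ∃ l : List A, l.IsChain R ∧ e <+: l ∧ m ≤ occurrences e l := by
  induction m with
  | zero => exact ⟨e, he, List.prefix_rfl, Nat.zero_le _⟩
  | succ m ih =>
    obtain ⟨l, hl, ⟨k, rfl⟩, hm⟩ := ih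
    obtain ⟨a, e, rfl⟩ := List.exists_cons_of_ne_nil hne
    obtain ⟨c, hc1, hc2⟩ := hR ((a :: e).getLast hne) a
    refine ⟨(a :: e) ++ c :: (a :: e ++ k), ?_, List.prefix_append _ _, ?_⟩
    · rw [List.isChain_append]
      refine ⟨he, List.isChain_cons_cons.2 ⟨hc2, hl⟩, ?_⟩
      intro x hx y hy
      rw [List.getLast?_eq_getLast_of_ne_nil hne, Option.mem_some_iff] at hx
      simp only [List.head?_cons, Option.mem_some_iff] at hy
      subst hx hy
      exact hc1
    · rw [List.cons_append, occurrences_cons hne, if_pos ⟨c :: (a :: e ++ k), rfl⟩]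
      have := occurrences_le_append hne (e ++ [c]) (a :: e ++ k)
      simp only [List.append_assoc, List.cons_append, List.nil_append] at this hm ⊢
      lia

variable [DecidableEq A] [Fintype ι]

/-- The linear combination of the counting functions of the words `w e`, with coefficients `f`. -/
def weightedCount (w : ι → List A) (f : ι → ℝ) (l : List A) : ℝ :=
  ∑ e, f e * (occurrences (w e) l : ℝ)

theorem IsEnumeration.weightedCount_eq_zero (hw : IsEnumeration R L w) (f : ι → ℝ) {l : List A}
    (hl : l.length < L) : weightedCount w f l = 0 :=
  Finset.sum_eq_zero fun e _ => by
    rw [occurrences_eq_zero_of_length_lt (by rwa [hw.length_eq]), Nat.cast_zero, mul_zero]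

/-- All enumerated words have the same length, so `e` alone occurs at the new initial position. -/
theorem IsEnumeration.weightedCount_cons (hw : IsEnumeration R L w) (hL : 1 ≤ L) (f : ι → ℝ)
    {a : A} {l : List A} {e : ι} (he : w e <+: a :: l) :
    weightedCount w f (a :: l) = weightedCount w f l + f e := by
  classical
  have hpre : ∀ i, w i <+: a :: l ↔ i = e := fun i =>
    ⟨fun h => hw.injective ((List.prefix_of_prefix_length_le h he
      (by simp [hw.length_eq])).eq_of_length (by simp [hw.length_eq])), fun h => h ▸ he⟩
  simp only [weightedCount, occurrences_cons (hw.ne_nil hL _), hpre, Nat.cast_add, mul_add,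
    Finset.sum_add_distrib]
  simp

variable {s t : ι → κ}

/-- The sum telescopes over the successive windows of length `L - 1`; finiteness of `κ` bounds the
boundary terms. -/
theorem abs_weightedCount_coboundary_le [Finite κ] (hw : IsEnumeration R L w)
    (hv : IsEnumeration R (L - 1) v) (hL : 1 ≤ L) (hs : ∀ e, v (s e) = (w e).tail)
    (ht : ∀ e, v (t e) = (w e).dropLast) (φ : κ → ℝ) :
    ∃ C : ℝ, ∀ l : List A, l.IsChain R → |weightedCount w (coboundary s t φ) l| ≤ C := by
  have := Fintype.ofFinite κ
  set ψ : List A → ℝ := Function.extend v φ 0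
  have hψv : ∀ k, ψ (v k) = φ k := fun k => hv.injective.extend_apply _ _ _
  obtain ⟨C, hC⟩ : ∃ C : ℝ, ∀ l, |ψ l| ≤ C := by
    refine ⟨∑ k, |φ k|, fun l => ?_⟩
    by_cases h : ∃ k, v k = l
    · obtain ⟨k, rfl⟩ := h
      rw [hψv]
      exact Finset.single_le_sum (f := fun k => |φ k|) (fun _ _ => abs_nonneg _)
        (Finset.mem_univ k)
    · simp only [ψ, Function.extend_apply' _ _ _ h, Pi.zero_apply, abs_zero]
      exact Finset.sum_nonneg fun _ _ => abs_nonneg _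
  -- Once the word has length at least `L - 1`, prepending a letter leaves this difference
  -- unchanged: the count grows by `φ (t e) - φ (s e)` while the initial window moves from `s e` to
  -- `t e`.
  have key : ∀ l : List A, l.IsChain R →
      |weightedCount w (coboundary s t φ) l - ψ (l.take (L - 1))| ≤ C := by
    intro l hl
    by_cases hlen : l.length < L
    · rw [hw.weightedCount_eq_zero _ hlen, zero_sub, abs_neg]
      exact hC _
    induction l with
    | nil => simp at hlen; lia
    | cons a l ih =>
      have ih : |weightedCount w (coboundary s t φ) l - ψ (l.take (L - 1))| ≤ C := by
        by_cases h : l.length < L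
        · rw [hw.weightedCount_eq_zero _ h, zero_sub, abs_neg]
          exact hC _
        · exact ih hl.tail h
      obtain ⟨e, he⟩ := hw.exists_eq ((a :: l).take L) (hl.prefix (List.take_prefix _ _))
        (by rw [List.length_take]; lia)
      rw [hw.weightedCount_cons hL _ (he ▸ List.take_prefix _ _), coboundary_apply,
        ← hψv, ← hψv, hs, ht, he]
      obtain ⟨L, rfl⟩ := Nat.exists_eq_add_of_le' hL
      rw [List.dropLast_eq_take, List.length_take, List.take_take,
        show min (min (L + 1) (a :: l).length - 1) (L + 1) = L by lia]
      simp only [List.take_succ_cons, List.tail_cons, Nat.add_sub_cancel] at ih ⊢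
      ring_nf at ih ⊢
      exact ih
  refine ⟨C + C, fun l hl => ?_⟩
  have h1 := abs_add_le (weightedCount w (coboundary s t φ) l - ψ (l.take (L - 1)))
    (ψ (l.take (L - 1)))
  rw [sub_add_cancel] at h1
  linarith [key l hl, hC (l.take (L - 1))]

/-- A bounded combination of counting functions is dominated by a coboundary: take for `φ` the
supremum over all words with a given prefix. -/
theorem exists_le_coboundary (hw : IsEnumeration R L w) (hv : IsEnumeration R (L - 1) v)
    (hL : 1 ≤ L) (hLR : 2 ≤ L ∨ ∀ a b, R a b) (hs : ∀ e, v (s e) = (w e).tail)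
    (ht : ∀ e, v (t e) = (w e).dropLast) {f : ι → ℝ} {C : ℝ}
    (hf : ∀ l : List A, l.IsChain R → |weightedCount w f l| ≤ C) :
    ∃ φ : κ → ℝ, ∀ e, f e ≤ coboundary s t φ e := by
  set φ : κ → ℝ := fun k => ⨆ l : {l : List A // l.IsChain R ∧ v k <+: l}, weightedCount w f l
  have hbdd : ∀ k, BddAbove (Set.range fun l : {l : List A // l.IsChain R ∧ v k <+: l} =>
      weightedCount w f l) := by
    rintro k
    refine ⟨C, ?_⟩
    rintro _ ⟨l, rfl⟩
    exact (le_abs_self _).trans (hf l l.2.1)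
  refine ⟨φ, fun e => ?_⟩
  suffices φ (s e) ≤ φ (t e) - f e by rw [coboundary_apply]; linarith
  have : Nonempty {l : List A // l.IsChain R ∧ v (s e) <+: l} :=
    ⟨⟨v (s e), hv.isChain _, List.prefix_rfl⟩⟩
  refine ciSup_le ?_
  rintro ⟨l, hl, hpre⟩
  -- Prepending the first letter `a` of `w e` turns a word beginning with `v (s e)` into one
  -- beginning with `v (t e)` and adds `f e` to the count.
  obtain ⟨a, u, hau⟩ := List.exists_cons_of_ne_nil (hw.ne_nil hL e)
  rw [hs, hau, List.tail_cons] at hpre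
  have hpre' : w e <+: a :: l := by rw [hau]; exact List.cons_prefix_cons.2 ⟨rfl, hpre⟩
  have hchain : (a :: l).IsChain R := by
    have hlen := hw.length_eq e
    have hch := hw.isChain e
    rw [hau] at hlen hch
    obtain ⟨m, rfl⟩ := hpre
    -- If `L = 1`, then `w e = [a]` says nothing about the letter following `a`, so `R` has to hold
    -- for all pairs.
    rcases u with - | ⟨b, u⟩
    · rcases m with - | ⟨b, m⟩
      · exact List.isChain_singleton a
      · refine List.isChain_cons_cons.2 ⟨hLR.resolve_left ?_ a b, hl⟩
        simp at hlen
        lia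
    · exact List.isChain_cons_cons.2 ⟨(List.isChain_cons_cons.1 hch).1, hl⟩
  have h1 : weightedCount w f (a :: l) ≤ φ (t e) :=
    le_ciSup (hbdd (t e)) ⟨a :: l, hchain, by
      rw [ht]; exact (List.dropLast_prefix _).trans hpre'⟩
  rw [hw.weightedCount_cons hL f hpre'] at h1
  simp only
  linarith

/-- A linear combination of counting functions of words of length `L` is bounded iff its
coefficients form a coboundary on the de Bruijn graph. -/
theorem exists_abs_weightedCount_le_iff [Finite κ] (hw : IsEnumeration R L w)
    (hv : IsEnumeration R (L - 1) v) (hL : 1 ≤ L) (hLR : 2 ≤ L ∨ ∀ a b, R a b)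
    (hR : ∀ a b, ∃ c, R a c ∧ R c b) (hs : ∀ e, v (s e) = (w e).tail)
    (ht : ∀ e, v (t e) = (w e).dropLast) (f : ι → ℝ) :
    (∃ C : ℝ, ∀ l : List A, l.IsChain R → |weightedCount w f l| ≤ C) ↔
      f ∈ (coboundary s t).range := by
  constructor
  · rintro ⟨C, hC⟩
    obtain ⟨φ, hφ⟩ := exists_le_coboundary hw hv hL hLR hs ht hC
    obtain ⟨D, hD⟩ := abs_weightedCount_coboundary_le hw hv hL hs ht φ
    refine ⟨φ, funext fun e => le_antisymm (not_lt.1 fun hlt => ?_) (hφ e)⟩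
    have hpos : 0 < coboundary s t φ e - f e := sub_pos.2 hlt
    -- The difference of the two counts is at most `D + C`, but `m` occurrences of `w e` push it
    -- beyond that.
    obtain ⟨m, hm⟩ := exists_nat_gt ((D + C) / (coboundary s t φ e - f e))
    obtain ⟨l, hl, -, hocc⟩ :=
      exists_isChain_le_occurrences hR (hw.isChain e) (hw.ne_nil hL e) m
    rw [div_lt_iff₀ hpos] at hm
    have h1 : (coboundary s t φ e - f e) * (occurrences (w e) l : ℝ) ≤
        weightedCount w (coboundary s t φ) l - weightedCount w f l := by
      rw [weightedCount, weightedCount, ← Finset.sum_sub_distrib]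
      simp only [← sub_mul]
      exact Finset.single_le_sum
        (f := fun i => (coboundary s t φ i - f i) * (occurrences (w i) l : ℝ))
        (fun i _ => mul_nonneg (sub_nonneg.2 (hφ i)) (Nat.cast_nonneg _)) (Finset.mem_univ e)
    have h2 : (m : ℝ) * (coboundary s t φ e - f e) ≤
        (coboundary s t φ e - f e) * (occurrences (w e) l : ℝ) := by
      rw [mul_comm]
      gcongr
    linarith [le_abs_self (weightedCount w (coboundary s t φ) l), hD l hl,
      neg_abs_le (weightedCount w f l), hC l hl]
  · rintro ⟨φ, rfl⟩
    exact abs_weightedCount_coboundary_le hw hv hL hs ht φ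

end Words

/-! ### Graphs of words -/

section WordGraphs

open Graph

variable {A X : Type*} {nf : X → List A} {R : A → A → Prop} {L : ℕ} {G : Graph X X}

/-- The vertices of `G` are the words of length `L - 1`, its edges are the words of length `L`, and
an edge joins the two words obtained by deleting its first, respectively last, letter. -/
structure IsWordGraph (nf : X → List A) (L : ℕ) (G : Graph X X) : Prop where
  vertexSet_eq : V(G) = wordsOfLength nf (L - 1)
  edgeSet_eq : E(G) = wordsOfLength nf L
  isLink_iff : ∀ e x y, G.IsLink e x y ↔ e ∈ wordsOfLength nf L ∧
    ((nf x = (nf e).tail ∧ nf y = (nf e).dropLast) ∨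
      (nf x = (nf e).dropLast ∧ nf y = (nf e).tail))

theorem finite_wordsOfLength [Finite A] (hnf : Function.Injective nf) (L : ℕ) :
    (wordsOfLength nf L).Finite :=
  (List.finite_length_eq A L).preimage hnf.injOn

theorem isEnumeration_wordsOfLength (hnf : Function.Injective nf)
    (hrange : ∀ l, l ∈ Set.range nf ↔ l.IsChain R) {U : Set X} (hU : U = wordsOfLength nf L) :
    IsEnumeration R L (fun x : U => nf x) where
  injective x y h := Subtype.ext (hnf h)
  isChain x := (hrange _).1 ⟨_, rfl⟩
  length_eq x := hU.subset x.2
  exists_eq l hl hlen := by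
    obtain ⟨x, rfl⟩ := (hrange l).2 hl
    exact ⟨⟨x, hU.superset hlen⟩, rfl⟩

/-- Adjacent windows of length `L - 1` are the `dropLast` and the `tail` of one window of length
`L`. -/
theorem eq_window_of_forall_eq {B : Type*} {Φ : List A → B} {l : List A} (hl : l.IsChain R)
    (h : ∀ e : List A, e.IsChain R → e.length = L → Φ e.tail = Φ e.dropLast) (hL : 1 ≤ L)
    {k : ℕ} (hk : k + (L - 1) ≤ l.length) :
    Φ ((l.drop k).take (L - 1)) = Φ (l.take (L - 1)) := by
  obtain ⟨L, rfl⟩ := Nat.exists_eq_add_of_le' hL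
  simp only [Nat.add_sub_cancel] at hk ⊢
  induction k with
  | zero => rfl
  | succ k ih =>
    have hlen : ((l.drop k).take (L + 1)).length = L + 1 := by
      rw [List.length_take, List.length_drop]; lia
    rw [← ih (by lia)]
    have := h ((l.drop k).take (L + 1))
      (hl.infix ((List.take_prefix _ _).isInfix.trans (List.drop_suffix _ _).isInfix)) hlen
    rwa [← List.drop_one, List.drop_take, List.drop_drop, List.dropLast_eq_take, hlen, List.take_take,
      Nat.add_sub_cancel, min_eq_left (by lia)] at this

/-- Join the words of `x` and `y` by a linking letter and slide a window from one to the other. -/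
theorem IsWordGraph.isConnected (hG : IsWordGraph nf L G) (hnf : Function.Injective nf)
    (hrange : ∀ l, l ∈ Set.range nf ↔ l.IsChain R) (hR : ∀ a b, ∃ c, R a c ∧ R c b) (hL : 1 ≤ L)
    (hne : V(G).Nonempty) : IsConnected G := by
  refine isConnected_iff_forall_potential.2 ⟨hne, fun φ hφ x hx y hy => ?_⟩
  set Φ : List A → ℝ := Function.extend nf φ 0
  have hΦ : ∀ x, Φ (nf x) = φ x := fun x => hnf.extend_apply _ _ _
  rw [hG.vertexSet_eq] at hx hy
  have hxlen : (nf x).length = L - 1 := hx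
  have hylen : (nf y).length = L - 1 := hy
  have hxch : (nf x).IsChain R := (hrange _).1 ⟨x, rfl⟩
  have hych : (nf y).IsChain R := (hrange _).1 ⟨y, rfl⟩
  -- This is the case `L = 1`, where the empty word is the only vertex.
  by_cases hx0 : nf x = []
  · have hy0 : nf y = [] := List.length_eq_zero_iff.1 (by rw [hylen, ← hxlen, hx0]; rfl)
    rw [hnf (hx0.trans hy0.symm)]
  have hy0 : nf y ≠ [] := fun h =>
    hx0 (List.length_eq_zero_iff.1 (by rw [hxlen, ← hylen, h]; rfl))
  obtain ⟨c, hc1, hc2⟩ := hR ((nf x).getLast hx0) ((nf y).head hy0)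
  have hchain : (nf x ++ c :: nf y).IsChain R := by
    rw [List.isChain_append]
    refine ⟨hxch, List.isChain_cons.2 ⟨fun b hb => ?_, hych⟩, fun a ha b hb => ?_⟩
    · rw [List.head?_eq_some_head hy0, Option.mem_some_iff] at hb
      exact hb ▸ hc2
    · rw [List.getLast?_eq_getLast_of_ne_nil hx0, Option.mem_some_iff] at ha
      simp only [List.head?_cons, Option.mem_some_iff] at hb
      subst ha hb
      exact hc1
  have hstep : ∀ e : List A, e.IsChain R → e.length = L → Φ e.tail = Φ e.dropLast := by
    intro e he hlen
    obtain ⟨e, rfl⟩ := (hrange e).2 he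
    obtain ⟨a, ha⟩ := (hrange _).2 (he.infix (List.tail_suffix _).isInfix)
    obtain ⟨b, hb⟩ := (hrange _).2 (he.infix (List.dropLast_prefix _).isInfix)
    rw [← ha, ← hb, hΦ, hΦ]
    exact hφ e a b ((hG.isLink_iff _ _ _).2 ⟨hlen, Or.inl ⟨ha, hb⟩⟩)
  -- After the `L - 1` letters of `x` and the link `c`, the word of `y` starts at position `L`.
  have h := eq_window_of_forall_eq hchain hstep hL (k := L) (by simp [hxlen, hylen]; lia)
  have h1 : (nf x ++ c :: nf y).take (L - 1) = nf x := List.take_left' hxlen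
  have h2 : (nf x ++ c :: nf y).drop L = nf y := by
    rw [List.append_cons]
    exact List.drop_left' (by simp [hxlen]; lia)
  rw [h1, h2, List.take_of_length_le hylen.le, hΦ, hΦ] at h
  exact h.symm

theorem deleteEdges_isSpanningSubgraph {V E : Type*} (G : Graph V E) (W : Set E) :
    G.deleteEdges W ≤s G :=
  ⟨deleteEdges_le, rfl⟩

theorem IsWordGraph.exists_source_target (hG : IsWordGraph nf L G)
    (hrange : ∀ l, l ∈ Set.range nf ↔ l.IsChain R) :
    ∃ s t : E(G) → V(G), (∀ e, nf (s e) = (nf e).tail) ∧ (∀ e, nf (t e) = (nf e).dropLast) ∧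
      ∀ e : E(G), G.IsLink (e : X) (s e : X) (t e : X) := by
  have h : ∀ e : E(G), ∃ x y : V(G), nf x = (nf e).tail ∧ nf y = (nf e).dropLast ∧
      G.IsLink (e : X) (x : X) (y : X) := by
    intro e
    obtain ⟨x, hx⟩ := (hrange _).2 (((hrange (nf e)).1 ⟨_, rfl⟩).infix
      (List.tail_suffix _).isInfix)
    obtain ⟨y, hy⟩ := (hrange _).2 (((hrange (nf e)).1 ⟨_, rfl⟩).infix
      (List.dropLast_prefix _).isInfix)
    have hlink := (hG.isLink_iff e x y).2 ⟨hG.edgeSet_eq.subset e.2, Or.inl ⟨hx, hy⟩⟩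
    exact ⟨⟨x, hlink.left_mem⟩, ⟨y, hlink.right_mem⟩, hx, hy, hlink⟩
  choose s t hs ht hst using h
  exact ⟨s, t, hs, ht, hst⟩

variable [DecidableEq A]

/-- Vanishing in the quotient is boundedness on `X`, and `nf` maps `X` onto the `R`-chains. -/
theorem sum_smul_countingClass_eq_zero_iff {ι : Type*} [Fintype ι]
    (hrange : ∀ l, l ∈ Set.range nf ↔ l.IsChain R) (w : ι → X) (f : ι → ℝ) :
    ∑ e, f e • countingClass nf (w e) = 0 ↔
      ∃ C : ℝ, ∀ l : List A, l.IsChain R → |weightedCount (fun e => nf (w e)) f l| ≤ C := by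
  have h : ∑ e, f e • countingClass nf (w e) =
      Submodule.Quotient.mk (∑ e, f e • (⟨countingFunction nf (w e),
        Submodule.subset_span ⟨w e, rfl⟩⟩ : countingSpace nf)) :=
    (map_sum (Submodule.mkQ ((boundedFunctions X).submoduleOf (countingSpace nf))) _ _).symm
  rw [h, Submodule.Quotient.mk_eq_zero, Submodule.submoduleOf, Submodule.mem_comap]
  have heval : ∀ x, ((∑ e, f e • (⟨countingFunction nf (w e),
      Submodule.subset_span ⟨w e, rfl⟩⟩ : countingSpace nf) : countingSpace nf) : X → ℝ) x =
        weightedCount (fun e => nf (w e)) f (nf x) := fun x => by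
    simp [weightedCount, countingFunction]
  refine exists_congr fun C => ⟨fun hC l hl => ?_, fun hC x => ?_⟩
  · obtain ⟨x, rfl⟩ := (hrange l).2 hl
    rw [← heval]
    exact hC x
  · exact (congrArg abs (heval x)).trans_le (hC _ ((hrange _).1 ⟨x, rfl⟩))

theorem span_countingClass_image_wordsOfLength (nf : X → List A) (L : ℕ) :
    Submodule.span ℝ (countingClass nf '' wordsOfLength nf L) = pureClasses nf L :=
  Finsupp.span_image_eq_map_linearCombination ℝ _

variable [Finite A]

theorem IsWordGraph.linearIndepOn_iff_and_finrank (hG : IsWordGraph nf L G)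
    (hnf : Function.Injective nf) (hrange : ∀ l, l ∈ Set.range nf ↔ l.IsChain R)
    (hR : ∀ a b, ∃ c, R a c ∧ R c b) (hL : 1 ≤ L) (hLR : 2 ≤ L ∨ ∀ a b, R a b)
    (hconn : IsConnected G) :
    (∀ W ⊆ wordsOfLength nf L,
      LinearIndepOn ℝ (countingClass nf) W ↔ IsConnected (G.deleteEdges W)) ∧
    Module.finrank ℝ (pureClasses nf L) + V(G).ncard = E(G).ncard + 1 := by
  obtain ⟨s, t, hs, ht, hst⟩ := hG.exists_source_target hrange
  have : Finite V(G) := hG.vertexSet_eq ▸ (finite_wordsOfLength hnf _).to_subtype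
  have : Fintype E(G) := Set.Finite.fintype (hG.edgeSet_eq ▸ finite_wordsOfLength hnf _)
  have hc := fun f : E(G) → ℝ =>
    (sum_smul_countingClass_eq_zero_iff hrange (fun e : E(G) => (e : X)) f).trans
      (exists_abs_weightedCount_le_iff (isEnumeration_wordsOfLength hnf hrange hG.edgeSet_eq)
        (isEnumeration_wordsOfLength hnf hrange hG.vertexSet_eq) hL hLR hR hs ht f)
  rw [← span_countingClass_image_wordsOfLength, ← hG.edgeSet_eq]
  exact ⟨fun W hW => linearIndepOn_iff_isConnected_deleteEdges hconn hst hc hW,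
    finrank_span_add_ncard_vertexSet hconn hst hc⟩

/-- Pure bases correspond to complements of spanning trees. -/
theorem IsWordGraph.isPureBasis_correspondence (hG : IsWordGraph nf L G)
    (hnf : Function.Injective nf) (hrange : ∀ l, l ∈ Set.range nf ↔ l.IsChain R)
    (hR : ∀ a b, ∃ c, R a c ∧ R c b) (hL : 1 ≤ L) (hLR : 2 ≤ L ∨ ∀ a b, R a b) {d : ℕ}
    (hd : d + (wordsOfLength nf (L - 1)).ncard = (wordsOfLength nf L).ncard + 1)
    (hne : (wordsOfLength nf (L - 1)).Nonempty) :
    (∀ W ⊆ wordsOfLength nf L, W.ncard = d →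
      (IsPureBasis nf L W ↔ IsConnected (G.deleteEdges W)) ∧
      (IsConnected (G.deleteEdges W) ↔ IsSpanningTree (G.deleteEdges W) G)) ∧
    Module.finrank ℝ (pureClasses nf L) = d ∧
    Set.BijOn (fun W => G.deleteEdges W) {W | IsPureBasis nf L W} {T | IsSpanningTree T G} := by
  obtain ⟨hind, hrank⟩ := hG.linearIndepOn_iff_and_finrank hnf hrange hR hL hLR
    (hG.isConnected hnf hrange hR hL (by rwa [hG.vertexSet_eq]))
  have hV := hG.vertexSet_eq
  have hE := hG.edgeSet_eq
  have hVfin : V(G).Finite := by rw [hV]; exact finite_wordsOfLength hnf _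
  have hEfin : E(G).Finite := by rw [hE]; exact finite_wordsOfLength hnf _
  rw [← hV, ← hE] at hd
  have hdim : Module.finrank ℝ (pureClasses nf L) = d := by lia
  have hfd : FiniteDimensional ℝ (pureClasses nf L) := by
    rw [← span_countingClass_image_wordsOfLength]
    exact FiniteDimensional.span_of_finite ℝ ((finite_wordsOfLength hnf L).image _)
  have hspan : ∀ W ⊆ wordsOfLength nf L, LinearIndepOn ℝ (countingClass nf) W →
      Module.finrank ℝ (Submodule.span ℝ (countingClass nf '' W)) = W.ncard := by
    intro W hWL hW
    have := ((finite_wordsOfLength hnf L).subset hWL).fintype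
    rw [Set.image_eq_range, finrank_span_eq_card hW, ← Set.toFinset_card,
      ← Set.ncard_eq_toFinset_card']
  -- The dimension forces `|W| = d`, so the bijection needs no separate cardinality condition.
  have hcard : ∀ W, IsPureBasis nf L W → W.ncard = d := fun W hW => by
    rw [← hspan W hW.subset hW.linearIndepOn, hW.span_eq, hdim]
  have hfinV : ∀ W, Finite V(G.deleteEdges W) := fun W => hVfin.to_subtype
  have hfinE : ∀ W, Finite E(G.deleteEdges W) := fun W => (hEfin.subset Set.sdiff_subset).to_subtype
  have hbasis : ∀ W ⊆ E(G), W.ncard = d → (IsPureBasis nf L W ↔ IsConnected (G.deleteEdges W)) := by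
    intro W hW hWd
    rw [← hind W (hE ▸ hW)]
    refine ⟨fun h => h.linearIndepOn, fun h => ⟨hE ▸ hW, h, ?_⟩⟩
    refine Submodule.eq_of_le_of_finrank_eq ?_ (by rw [hspan W (hE ▸ hW) h, hWd, hdim])
    rw [← span_countingClass_image_wordsOfLength]
    exact Submodule.span_mono (Set.image_mono (hE ▸ hW))
  have htree : ∀ W ⊆ E(G), W.ncard = d →
      (IsConnected (G.deleteEdges W) ↔ IsSpanningTree (G.deleteEdges W) G) := by
    intro W hW hWd
    refine ⟨fun h => ⟨deleteEdges_isSpanningSubgraph G W, h, h.isAcyclic_iff.2 ?_⟩,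
      fun h => h.connected⟩
    have h1 : E(G.deleteEdges W).ncard + W.ncard = E(G).ncard :=
      Set.ncard_sdiff_add_ncard_of_subset hW hEfin
    have h2 : V(G.deleteEdges W).ncard = V(G).ncard := rfl
    lia
  refine ⟨fun W hW hWd => ⟨hbasis W (hE ▸ hW) hWd, htree W (hE ▸ hW) hWd⟩, hdim,
    fun W hW => ?_, fun W hW W' hW' h => ?_, fun T hT => ?_⟩
  · have hWE : W ⊆ E(G) := hE ▸ hW.subset
    exact (htree W hWE (hcard W hW)).1 ((hbasis W hWE (hcard W hW)).1 hW)
  · have h1 : E(G) \ W = E(G) \ W' := congrArg Graph.edgeSet h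
    rw [← Set.sdiff_sdiff_cancel_left (hE ▸ hW.subset : W ⊆ E(G)), h1,
      Set.sdiff_sdiff_cancel_left (hE ▸ hW'.subset : W' ⊆ E(G))]
  · have hTE : E(T) ⊆ E(G) := hT.spanning.le.edgeSet_mono
    have hTV : V(T) = V(G) := hT.spanning.vertexSet_eq
    have : Finite V(T) := by rw [hTV]; exact hVfin.to_subtype
    have : Finite E(T) := (hEfin.subset hTE).to_subtype
    have hTcard := hT.connected.isAcyclic_iff.1 hT.acyclic
    have hWE : E(G) \ E(T) ⊆ E(G) := Set.sdiff_subset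
    have hWd : (E(G) \ E(T)).ncard = d := by
      have := Set.ncard_sdiff_add_ncard_of_subset hTE hEfin
      rw [hTV] at hTcard
      lia
    have hTeq : G.deleteEdges (E(G) \ E(T)) = T := by
      refine Graph.ext hTV.symm fun e x y => ⟨?_, fun h => ?_⟩
      · rintro ⟨h, he⟩
        have heT : e ∈ E(T) := by_contra fun h' => he ⟨h.edge_mem, h'⟩
        exact h.of_compatible (Compatible.of_le hT.spanning.le).symm heT
      · exact ⟨h.mono hT.spanning.le, fun h' => h'.2 h.edge_mem⟩
    refine ⟨E(G) \ E(T), (hbasis _ hWE hWd).2 ?_, hTeq⟩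
    rw [hTeq]
    exact hT.connected

end WordGraphs

/-! ### The number of words -/

section Count

variable {A X : Type*} {R : A → A → Prop}

theorem ncard_wordsOfLength {nf : X → List A} (hnf : Function.Injective nf)
    (hrange : ∀ l, l ∈ Set.range nf ↔ l.IsChain R) (L : ℕ) :
    (wordsOfLength nf L).ncard = {l : List A | l.IsChain R ∧ l.length = L}.ncard := by
  rw [← Set.ncard_image_of_injective _ hnf]
  congr 1
  ext l
  constructor
  · rintro ⟨x, hx, rfl⟩
    exact ⟨(hrange _).1 ⟨x, rfl⟩, hx⟩
  · rintro ⟨hl, hlen⟩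
    obtain ⟨x, rfl⟩ := (hrange l).2 hl
    exact ⟨x, hlen, rfl⟩

/-- Fibre the words over their tails: a nonempty tail with head `b` has `d` admissible letters to
put in front. -/
theorem ncard_isChain_length_eq [Fintype A] [DecidableRel R] {d : ℕ} (hd : ∀ b, #{a | R a b} = d) (m : ℕ) :
    {l : List A | l.IsChain R ∧ l.length = m + 1}.ncard = Fintype.card A * d ^ m := by
  classical
  have hfin : ∀ k, {l : List A | l.IsChain R ∧ l.length = k}.Finite := fun k =>
    (List.finite_length_eq A k).subset fun l hl => hl.2
  induction m with
  | zero =>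
    have : {l : List A | l.IsChain R ∧ l.length = 0 + 1} = Set.range fun a => [a] := by
      ext l
      simp only [zero_add, List.length_eq_one_iff, Set.mem_range]
      exact ⟨fun ⟨_, a, h⟩ => ⟨a, h.symm⟩, fun ⟨a, h⟩ => h ▸ ⟨List.isChain_singleton a, a, rfl⟩⟩
    rw [this, ← Set.image_univ, Set.ncard_image_of_injective _ fun a b h => by simpa using h,
      Set.ncard_univ, Nat.card_eq_fintype_card, pow_zero, mul_one]
  | succ m ih =>
    rw [Set.ncard_eq_toFinset_card _ (hfin _)] at ih ⊢
    rw [Finset.card_eq_sum_card_fiberwise (f := List.tail) (t := (hfin (m + 1)).toFinset),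
      Finset.sum_const_nat (m := d), ih, pow_succ, mul_assoc]
    · intro l hl
      obtain ⟨hl, hlen⟩ := (hfin _).mem_toFinset.1 hl
      obtain ⟨b, l, rfl⟩ := List.exists_cons_of_length_eq_add_one hlen
      rw [← hd b, ← Finset.card_image_of_injective (f := fun a => a :: b :: l) _
        fun a a' h => by simpa using h]
      congr 1
      ext k
      simp only [Finset.mem_filter, Set.Finite.mem_toFinset, Finset.mem_image, Finset.mem_univ,
        true_and]
      constructor
      · rintro ⟨⟨hk, hklen⟩, htail⟩
        obtain ⟨a, k, rfl⟩ := List.exists_cons_of_length_eq_add_one hklen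
        obtain rfl : k = b :: l := htail
        exact ⟨a, (List.isChain_cons_cons.1 hk).1, rfl⟩
      · rintro ⟨a, ha, rfl⟩
        exact ⟨⟨List.isChain_cons_cons.2 ⟨ha, hl⟩, by simpa using hlen⟩, rfl⟩
    · intro l hl
      obtain ⟨hl, hlen⟩ := (hfin _).mem_toFinset.1 hl
      exact (hfin _).mem_toFinset.2 ⟨hl.tail, by simp [hlen]⟩

variable {S : Type*}

theorem mem_range_toList_iff (l : List S) :
    l ∈ Set.range (FreeMonoid.toList (α := S)) ↔ l.IsChain (fun _ _ => True) :=
  iff_of_true ⟨FreeMonoid.ofList l, rfl⟩ (List.isChain_iff_getElem.2 fun _ _ => trivial)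

theorem mem_range_toWord_iff [DecidableEq S] (l : List (S × Bool)) :
    l ∈ Set.range (FreeGroup.toWord (α := S)) ↔ l.IsChain (fun a b => a.1 = b.1 → a.2 = b.2) := by
  constructor
  · rintro ⟨x, rfl⟩
    exact FreeGroup.isReduced_toWord
  · intro h
    refine ⟨FreeGroup.mk l, ?_⟩
    rw [FreeGroup.toWord_mk]
    exact FreeGroup.IsReduced.reduce_eq h

variable [Fintype S]

theorem ncard_wordsOfLength_freeMonoid (L : ℕ) :
    (wordsOfLength (FreeMonoid.toList (α := S)) L).ncard = Fintype.card S ^ L := by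
  rw [ncard_wordsOfLength FreeMonoid.toList.injective mem_range_toList_iff]
  rcases L with - | L
  · have : {l : List S | l.IsChain (fun _ _ => True) ∧ l.length = 0} = {[]} := by
      ext l
      simp only [List.length_eq_zero_iff, Set.mem_singleton_iff]
      exact ⟨fun h => h.2, by rintro rfl; exact ⟨List.isChain_nil, rfl⟩⟩
    rw [this, Set.ncard_singleton, pow_zero]
  · rw [ncard_isChain_length_eq (d := Fintype.card S) (fun b => by simp), pow_succ']

variable [DecidableEq S]

theorem ncard_wordsOfLength_freeGroup (L : ℕ) :
    (wordsOfLength (FreeGroup.toWord (α := S)) (L + 1)).ncard =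
      2 * Fintype.card S * (2 * Fintype.card S - 1) ^ L := by
  rw [ncard_wordsOfLength FreeGroup.toWord_injective mem_range_toWord_iff,
    ncard_isChain_length_eq (d := 2 * Fintype.card S - 1), Fintype.card_prod, Fintype.card_bool,
    mul_comm (Fintype.card S)]
  intro b
  -- Only the inverse of `b` is forbidden next to `b`.
  have : ({a | a.1 = b.1 → a.2 = b.2} : Finset (S × Bool)) = Finset.univ.erase (b.1, !b.2) := by
    ext ⟨x, u⟩
    obtain ⟨y, v⟩ := b
    cases u <;> cases v <;> simp
  rw [this, Finset.card_erase_of_mem (Finset.mem_univ _), Finset.card_univ, Fintype.card_prod,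
    Fintype.card_bool, mul_comm]

/-- Only the inverses of `a` and `b` are excluded, and there are at least four letters. -/
theorem exists_reduced_between (hS : 2 ≤ Fintype.card S) (a b : S × Bool) :
    ∃ c : S × Bool, (a.1 = c.1 → a.2 = c.2) ∧ (c.1 = b.1 → c.2 = b.2) := by
  obtain ⟨c, -, hc⟩ := Finset.exists_mem_notMem_of_card_lt_card
    (s := {(a.1, !a.2), (b.1, !b.2)}) (t := (Finset.univ : Finset (S × Bool)))
    (lt_of_le_of_lt Finset.card_le_two (by
      rw [Finset.card_univ, Fintype.card_prod, Fintype.card_bool]; lia))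
  refine ⟨c, ?_⟩
  obtain ⟨x, u⟩ := a
  obtain ⟨y, v⟩ := b
  obtain ⟨z, w⟩ := c
  simp only [Finset.mem_insert, Finset.mem_singleton, not_or, Prod.mk.injEq, not_and] at hc
  refine ⟨fun h => ?_, fun h => ?_⟩
  · have := hc.1 h.symm
    revert this; cases u <;> cases w <;> simp
  · have := hc.2 h
    revert this; cases v <;> cases w <;> simp

end Count

end CountingFunctions

/-! ### The free monoid and the free group -/

theorem proposition3p1 {S : Type*} [Fintype S] [DecidableEq S] (n : ℕ) (hn : 2 ≤ n)
    (hS : Fintype.card S = n) :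
    -- the free monoid
    (∀ L : ℕ, 1 ≤ L →
      (∀ W : Set (FreeMonoid S),
        W ⊆ CountingFunctions.wordsOfLength FreeMonoid.toList L →
        W.ncard = (n - 1) * n ^ (L - 1) + 1 →
        List.TFAE
          [CountingFunctions.IsPureBasis FreeMonoid.toList L W,
            CountingFunctions.IsConnected
              ((CountingFunctions.deBruijnGraph S L).deleteEdges W),
            -- the same for the subgraph of the loop-erased de Bruijn graph
            ((CountingFunctions.deBruijnGraph S L).deleteEdges W).toSimpleGraph.Connected,
            CountingFunctions.IsSpanningTree
              ((CountingFunctions.deBruijnGraph S L).deleteEdges W)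
              (CountingFunctions.deBruijnGraph S L)]) ∧
      Module.finrank ℝ (CountingFunctions.pureClasses (FreeMonoid.toList (α := S)) L) =
        (n - 1) * n ^ (L - 1) + 1 ∧
      Set.BijOn (fun W => (CountingFunctions.deBruijnGraph S L).deleteEdges W)
        {W | CountingFunctions.IsPureBasis FreeMonoid.toList L W}
        {T | CountingFunctions.IsSpanningTree T (CountingFunctions.deBruijnGraph S L)}) ∧
    -- the free group
    (∀ L : ℕ, 2 ≤ L →
      (∀ W : Set (FreeGroup S),
        W ⊆ CountingFunctions.wordsOfLength FreeGroup.toWord L →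
        W.ncard = 2 * n * (2 * n - 1) ^ (L - 2) * (2 * n - 2) + 1 →
        List.TFAE
          [CountingFunctions.IsPureBasis FreeGroup.toWord L W,
            CountingFunctions.IsConnected
              ((CountingFunctions.martinDeBruijnGraph S L).deleteEdges W),
            CountingFunctions.IsSpanningTree
              ((CountingFunctions.martinDeBruijnGraph S L).deleteEdges W)
              (CountingFunctions.martinDeBruijnGraph S L)]) ∧
      Module.finrank ℝ (CountingFunctions.pureClasses (FreeGroup.toWord (α := S)) L) =
        2 * n * (2 * n - 1) ^ (L - 2) * (2 * n - 2) + 1 ∧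
      Set.BijOn (fun W => (CountingFunctions.martinDeBruijnGraph S L).deleteEdges W)
        {W | CountingFunctions.IsPureBasis FreeGroup.toWord L W}
        {T | CountingFunctions.IsSpanningTree T (CountingFunctions.martinDeBruijnGraph S L)}) := by
  subst hS
  have hpos : 0 < Fintype.card S := by lia
  refine ⟨fun L hL => ?_, fun L hL => ?_⟩
  · have hG : CountingFunctions.IsWordGraph FreeMonoid.toList L
        (CountingFunctions.deBruijnGraph S L) := ⟨rfl, rfl, fun _ _ _ => Iff.rfl⟩
    have hne : (CountingFunctions.wordsOfLength (FreeMonoid.toList (α := S)) (L - 1)).Nonempty :=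
      Set.nonempty_of_ncard_ne_zero (by
        rw [CountingFunctions.ncard_wordsOfLength_freeMonoid]; positivity)
    obtain ⟨h, hdim, hbij⟩ := hG.isPureBasis_correspondence FreeMonoid.toList.injective
      CountingFunctions.mem_range_toList_iff (fun a _ => ⟨a, trivial, trivial⟩) hL
      (Or.inr fun _ _ => trivial) (d := (Fintype.card S - 1) * Fintype.card S ^ (L - 1) + 1)
      (by
        rw [CountingFunctions.ncard_wordsOfLength_freeMonoid,
          CountingFunctions.ncard_wordsOfLength_freeMonoid]
        obtain ⟨m, rfl⟩ := Nat.exists_eq_add_of_le' hL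
        obtain ⟨k, hk⟩ := Nat.exists_eq_add_of_le' hpos
        rw [hk, Nat.add_sub_cancel, Nat.add_sub_cancel]
        ring) hne
    refine ⟨fun W hW hWd => ?_, hdim, hbij⟩
    obtain ⟨h1, h2⟩ := h W hW hWd
    tfae_have 1 ↔ 2 := h1
    tfae_have 2 ↔ 3 := CountingFunctions.isConnected_iff_connected_toSimpleGraph
    tfae_have 2 ↔ 4 := h2
    tfae_finish
  · obtain ⟨m, rfl⟩ := Nat.exists_eq_add_of_le' hL
    have hG : CountingFunctions.IsWordGraph FreeGroup.toWord (m + 2)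
        (CountingFunctions.martinDeBruijnGraph S (m + 2)) := ⟨rfl, rfl, fun _ _ _ => Iff.rfl⟩
    have hV := CountingFunctions.ncard_wordsOfLength_freeGroup (S := S) m
    have hE := CountingFunctions.ncard_wordsOfLength_freeGroup (S := S) (m + 1)
    have hpos' : 0 < 2 * Fintype.card S - 1 := by lia
    obtain ⟨h, hdim, hbij⟩ := hG.isPureBasis_correspondence FreeGroup.toWord_injective
      CountingFunctions.mem_range_toWord_iff (CountingFunctions.exists_reduced_between hn)
      (by lia) (Or.inl (by lia))
      (d := 2 * Fintype.card S * (2 * Fintype.card S - 1) ^ m * (2 * Fintype.card S - 2) + 1)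
      (by
        rw [show m + 2 - 1 = m + 1 from rfl, hV, hE]
        obtain ⟨k, hk⟩ := Nat.exists_eq_add_of_le' hn
        rw [hk, show 2 * (k + 2) - 2 = 2 * k + 2 by lia, show 2 * (k + 2) - 1 = 2 * k + 3 by lia]
        ring)
      (Set.nonempty_of_ncard_ne_zero (by
        rw [show m + 2 - 1 = m + 1 from rfl, hV]; positivity))
    refine ⟨fun W hW hWd => ?_, hdim, hbij⟩
    obtain ⟨h1, h2⟩ := h W hW hWd
    tfae_have 1 ↔ 2 := h1
    tfae_have 2 ↔ 3 := h2
    tfae_finish
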